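/- For a finite-dimensional real Lie algebra $\mathfrak l$, identify $\Lambda\mathfrak l^*$ with the dual of $\Lambda\mathfrak l$ and let $$P_{\mathfrak l^*}=\{\alpha\in(\Lambda^+\mathfrak l^*)^{\mathfrak l} : \alpha(x\wedge y)=0 \text{ for all } x,y\in(\Lambda^+\mathfrak l)^{\mathfrak l}\}$$ be the space of primitive elements, where $\Lambda^+$ is the positive-degree part and $(\cdot)^{\mathfrak l}$ denotes invariants under the (co)adjoint action. For an involutive automorphism $\theta$ of $\mathfrak l$, let $(P_{\mathfrak l^*})^{-\theta}$ be the $(-1)$-eigenspace of the induced action of $\theta$ on $P_{\mathfrak l^*}$. **Proposition.** Let $\mathfrak g$ be a finite-dimensional real semisimple Lie algebra, $\sigma$ an involution of $\mathfrak g$ (an automorphism with $\sigma^2=1$), $\mathfrak h=\mathfrak g^{\sigma}$, $\mathfrak q=\mathfrak g^{-\sigma}$, and $\theta$ a Cartan involution of $\mathfrak g$ with $\theta\sigma=\sigma\theta$. Let $\mathfrak g^c=\mathfrak h\oplus\sqrt{-1}\,\mathfrak q\subset\mathfrak g_{\mathbb C}=\mathfrak g\otimes_{\mathbb R}\mathbb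 C$, so that $(\mathfrak g^c,\mathfrak h)$ is the $c$-dual of the semisimple symmetric pair $(\mathfrak g,\mathfrak h)$, and let $\theta^c$ be the Cartan involution of $\mathfrak g^c$ given by $\theta^c|_{\mathfrak h}=\theta$ and $\theta^c(\sqrt{-1}\,Y)=-\sqrt{-1}\,\theta(Y)$ for $Y\in\mathfrak q$. Then the restriction map $$(P_{\mathfrak g^*})^{-\theta}\longrightarrow(P_{\mathfrak h^*})^{-\theta}$$ is surjective if and only if the restriction map $$(P_{(\mathfrak g^c)^*})^{-\theta^c}\longrightarrow(P_{\mathfrak h^*})^{-\theta^c}$$ is surjective. -/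

import Mathlib

open TensorProduct

noncomputable section

namespace CDual

/-! ### Primitive elements

For a finite-dimensional Lie algebra `L`, the exterior algebra `Λ L*` is identified with the
dual space of the exterior algebra `Λ L`, so that an element `α` of `Λ L*` is evaluated on
elements of `Λ L`. -/

section Primitive

variable (R : Type*) {L : Type*} [CommRing R] [LieRing L] [LieAlgebra R L]

/-- The algebra map `Λ L → (Λ L)[ε]` that extends `m ↦ m + ε [X, m]`. -/
def adDual (X : L) : ExteriorAlgebra R L →ₐ[R] DualNumber (ExteriorAlgebra R L) :=
  ExteriorAlgebra.lift R
    ⟨(TrivSqZeroExt.inlAlgHom R (ExteriorAlgebra R L) (ExteriorAlgebra R L)).toLinearMap ∘ₗ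
        ExteriorAlgebra.ι R +
      (TrivSqZeroExt.inrHom (ExteriorAlgebra R L) (ExteriorAlgebra R L)).restrictScalars R ∘ₗ
        ExteriorAlgebra.ι R ∘ₗ (LieAlgebra.ad R L X : L →ₗ[R] L), by
      intro m
      ext
      · simp
      · simp [ExteriorAlgebra.ι_add_mul_swap]⟩

theorem adDual_fst (X : L) (w : ExteriorAlgebra R L) : (adDual R X w).fst = w := by
  have h : (TrivSqZeroExt.fstHom R (ExteriorAlgebra R L) (ExteriorAlgebra R L)).comp (adDual R X)
      = AlgHom.id R _ := by
    ext m
    simp [adDual]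
  exact DFunLike.congr_fun h w

/-- The action of `X : L` on `Λ L` induced by the adjoint representation: the derivation that
extends `m ↦ [X, m]` (see `adExt_ι` and `adExt_mul`). -/
def adExt (X : L) : ExteriorAlgebra R L →ₗ[R] ExteriorAlgebra R L :=
  (TrivSqZeroExt.sndHom (ExteriorAlgebra R L) (ExteriorAlgebra R L)).restrictScalars R ∘ₗ
    (adDual R X).toLinearMap

theorem adExt_ι (X m : L) :
    adExt R X (ExteriorAlgebra.ι R m) = ExteriorAlgebra.ι R ⁅X, m⁆ := by
  simp [adExt, adDual]

theorem adExt_mul (X : L) (v w : ExteriorAlgebra R L) :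
    adExt R X (v * w) = adExt R X v * w + v * adExt R X w := by
  simp [adExt, adDual_fst, add_comm]

variable (L)

/-- `(Λ⁺ L)^L`: the invariant elements of `Λ L` without component in degree `0`. -/
def posInvariants : Submodule R (ExteriorAlgebra R L) where
  carrier := {w | ExteriorAlgebra.algebraMapInv w = 0 ∧ ∀ X : L, adExt R X w = 0}
  zero_mem' := by simp
  add_mem' := by
    rintro v w ⟨hv, hv'⟩ ⟨hw, hw'⟩
    exact ⟨by simp [hv, hw], fun X => by simp [hv' X, hw' X]⟩
  smul_mem' := by
    rintro c w ⟨hw, hw'⟩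
    exact ⟨by simp [hw], fun X => by simp [hw' X]⟩

/-- The space `P_{L*}` of primitive elements of `(Λ L*)^L`: the `L`-invariant elements `α` of
`Λ⁺ L*` such that `α (x ∧ y) = 0` for all `x, y` in `(Λ⁺ L)^L`. -/
def primitives : Submodule R (Module.Dual R (ExteriorAlgebra R L)) where
  carrier := {α | α 1 = 0 ∧ (∀ (X : L) (w : ExteriorAlgebra R L), α (adExt R X w) = 0) ∧
    ∀ x ∈ posInvariants R L, ∀ y ∈ posInvariants R L, α (x * y) = 0}
  zero_mem' := by simp
  add_mem' := by
    rintro α β ⟨h1, h2, h3⟩ ⟨k1, k2, k3⟩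
    exact ⟨by simp [h1, k1], fun X w => by simp [h2 X w, k2 X w],
      fun x hx y hy => by simp [h3 x hx y hy, k3 x hx y hy]⟩
  smul_mem' := by
    rintro c α ⟨h1, h2, h3⟩
    exact ⟨by simp [h1], fun X w => by simp [h2 X w], fun x hx y hy => by simp [h3 x hx y hy]⟩

variable {L} {M : Type*} [LieRing M] [LieAlgebra R M]

/-- The pull-back `Λ M* → Λ L*` along a linear map `f : L → M`. -/
def pullback (f : L →ₗ[R] M) :
    Module.Dual R (ExteriorAlgebra R M) →ₗ[R] Module.Dual R (ExteriorAlgebra R L) :=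
  (ExteriorAlgebra.map f).toLinearMap.dualMap

/-- `(P_{L*})^{-f}`: the `(-1)`-eigenspace in `P_{L*}` of the map of `Λ L*` induced by `f`. -/
def antiPrimitives (f : L →ₗ[R] L) : Submodule R (Module.Dual R (ExteriorAlgebra R L)) :=
  primitives R L ⊓ Module.End.eigenspace (pullback R f) (-1)

variable {R}

/-- The restriction `(P_{L*})^{-θ} → (P_{h*})^{-θ}` is surjective, for a subalgebra `h` of `L`
that is stable under `θ`. -/
def RestrictionSurjective (h : LieSubalgebra R L) (θ : L →ₗ⁅R⁆ L) (hθ : ∀ X ∈ h, θ X ∈ h) : Prop :=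
  Set.SurjOn (pullback R (h.incl : h →ₗ[R] L))
    (antiPrimitives R (θ : L →ₗ[R] L))
    (antiPrimitives R (L := h)
      ((θ : L →ₗ[R] L).restrict (p := h.toSubmodule) (q := h.toSubmodule) hθ) :
        Set (Module.Dual R (ExteriorAlgebra R h)))

end Primitive

/-! ### Symmetric pairs and their `c`-duals -/

section Symmetric

variable {g : Type*} [LieRing g] [LieAlgebra ℝ g]

/-- `θ` is a Cartan involution of the semisimple Lie algebra `g`: an involutive automorphism for
which `-B(X, θ Y)` is positive definite, where `B` is the Killing form. -/
def IsCartanInvolution (θ : g →ₗ⁅ℝ⁆ g) : Prop :=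
  Function.Involutive θ ∧ ∀ X : g, X ≠ 0 → 0 < -killingForm ℝ g X (θ X)

/-- `g^σ`, the subalgebra of the fixed points of `σ`. -/
def fixed (σ : g →ₗ⁅ℝ⁆ g) : LieSubalgebra ℝ g where
  carrier := {X | σ X = X}
  zero_mem' := by simp
  add_mem' := by
    intro X Y (hX : σ X = X) (hY : σ Y = Y)
    simp [hX, hY]
  smul_mem' := by
    intro c X (hX : σ X = X)
    simp [hX]
  lie_mem' := by
    intro X Y (hX : σ X = X) (hY : σ Y = Y)
    simp [LieHom.map_lie, hX, hY]

/-- `g^c = h ⊕ √-1 q ⊂ ℂ ⊗ g`, where `h = g^σ` and `q = g^{-σ}`. -/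
def cDual (σ : g →ₗ⁅ℝ⁆ g) : LieSubalgebra ℝ (ℂ ⊗[ℝ] g) where
  carrier := {z | ∃ X Y : g, σ X = X ∧ σ Y = -Y ∧
    z = (1 : ℂ) ⊗ₜ[ℝ] X + Complex.I ⊗ₜ[ℝ] Y}
  zero_mem' := ⟨0, 0, by simp, by simp, by simp⟩
  add_mem' := by
    rintro _ _ ⟨X, Y, hX, hY, rfl⟩ ⟨X', Y', hX', hY', rfl⟩
    refine ⟨X + X', Y + Y', by simp [hX, hX'], by simp [hY, hY', add_comm], ?_⟩
    simp only [tmul_add]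
    abel
  smul_mem' := by
    rintro c _ ⟨X, Y, hX, hY, rfl⟩
    exact ⟨c • X, c • Y, by simp [hX], by simp [hY], by simp only [smul_add, tmul_smul]⟩
  lie_mem' := by
    rintro _ _ ⟨X, Y, hX, hY, rfl⟩ ⟨X', Y', hX', hY', rfl⟩
    refine ⟨⁅X, X'⁆ - ⁅Y, Y'⁆, ⁅X, Y'⁆ + ⁅Y, X'⁆, by simp [LieHom.map_lie, hX, hX', hY, hY'],
      by simp [LieHom.map_lie, hX, hX', hY, hY', add_comm], ?_⟩
    simp only [add_lie, lie_add, LieAlgebra.ExtendScalars.bracket_tmul, one_mul, mul_one,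
      Complex.I_mul_I, tmul_add, tmul_sub, neg_tmul]
    abel

/-- `h = g^σ` as a subalgebra of `g^c`. -/
def cDualFixed (σ : g →ₗ⁅ℝ⁆ g) : LieSubalgebra ℝ (cDual σ) where
  carrier := {z | ∃ X : g, σ X = X ∧ (z : ℂ ⊗[ℝ] g) = (1 : ℂ) ⊗ₜ[ℝ] X}
  zero_mem' := ⟨0, by simp, by simp⟩
  add_mem' := by
    rintro z w ⟨X, hX, hz⟩ ⟨Y, hY, hw⟩
    exact ⟨X + Y, by simp [hX, hY], by simp [hz, hw, tmul_add]⟩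
  smul_mem' := by
    rintro c z ⟨X, hX, hz⟩
    exact ⟨c • X, by simp [hX], by simp [hz]⟩
  lie_mem' := by
    rintro z w ⟨X, hX, hz⟩ ⟨Y, hY, hw⟩
    exact ⟨⁅X, Y⁆, by simp [LieHom.map_lie, hX, hY], by simp [hz, hw]⟩

variable {σ θ : g →ₗ⁅ℝ⁆ g}

theorem map_mem_fixed (hc : ∀ X, θ (σ X) = σ (θ X)) : ∀ X ∈ fixed σ, θ X ∈ fixed σ := by
  intro X (hX : σ X = X)
  change σ (θ X) = θ X
  rw [← hc, hX]

/-- The complex linear extension of `θ ∘ σ` to `ℂ ⊗ g`. -/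
def complexExtension (σ θ : g →ₗ⁅ℝ⁆ g) : ℂ ⊗[ℝ] g →ₗ⁅ℝ⁆ ℂ ⊗[ℝ] g :=
  LieAlgebra.ExtendScalars.map (AlgHom.id ℝ ℂ) (θ.comp σ)

theorem complexExtension_mem (hc : ∀ X, θ (σ X) = σ (θ X)) :
    ∀ z ∈ cDual σ, complexExtension σ θ z ∈ cDual σ := by
  rintro _ ⟨X, Y, hX, hY, rfl⟩
  refine ⟨θ X, -θ Y, by rw [← hc, hX], by rw [map_neg, ← hc, hY, map_neg], ?_⟩
  simp [complexExtension, hX, hY]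

/-- The involution `θ^c` of `g^c`, equal to `θ` on `h` and to `-θ` on `√-1 q`
(see `thetaC_apply`). -/
def thetaC (hc : ∀ X, θ (σ X) = σ (θ X)) : cDual σ →ₗ⁅ℝ⁆ cDual σ where
  toFun z := ⟨complexExtension σ θ z, complexExtension_mem hc z z.2⟩
  map_add' z w := by ext; simp
  map_smul' c z := by ext; simp
  map_lie' {z w} := by ext; simp

theorem thetaC_apply (hc : ∀ X, θ (σ X) = σ (θ X)) (z : cDual σ) (X Y : g)
    (hX : σ X = X) (hY : σ Y = -Y)
    (hz : (z : ℂ ⊗[ℝ] g) = (1 : ℂ) ⊗ₜ[ℝ] X + Complex.I ⊗ₜ[ℝ] Y) :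
    (thetaC hc z : ℂ ⊗[ℝ] g) = (1 : ℂ) ⊗ₜ[ℝ] (θ X) - Complex.I ⊗ₜ[ℝ] (θ Y) := by
  simp [thetaC, complexExtension, hz, hX, hY, sub_eq_add_neg, tmul_neg]

theorem thetaC_mem (hc : ∀ X, θ (σ X) = σ (θ X)) :
    ∀ z ∈ cDualFixed σ, thetaC hc z ∈ cDualFixed σ := by
  rintro z ⟨X, hX, hz⟩
  refine ⟨θ X, by rw [← hc, hX], ?_⟩
  simp [thetaC, complexExtension, hz, hX]

end Symmetric

end CDual

end

/-! `g` and `g^c` are two real forms of `ℂ ⊗ g`. A form on one of them extends `ℂ`-linearly to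
`ℂ ⊗ g`, restricts to the other, and the real part of this restriction is again primitive: it
vanishes on products of positive invariants because such products, after base change to `ℂ`, lie in
the complex span of products of positive invariants of the first real form. On `h` nothing happens.

What `θ^c` corresponds to under `ℂ ⊗ g^c ≃ ℂ ⊗ g` is the `ℂ`-linear extension of `θσ`, not of `θ`.
But `σ` is the identity on `h`, so averaging an extension of a form on `h` over `σ` does not change
its restriction, and it allows `θ` to be replaced by `θσ`. -/

noncomputable section

namespace CDual

open ExteriorAlgebra

section Pullback

variable {R : Type*} [CommRing R] {L M N : Type*} [LieRing L] [LieAlgebra R L] [LieRing M]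
  [LieAlgebra R M] [LieRing N] [LieAlgebra R N]

@[simp]
theorem pullback_apply (f : L →ₗ[R] M) (α : Module.Dual R (ExteriorAlgebra R M))
    (w : ExteriorAlgebra R L) : pullback R f α w = α (ExteriorAlgebra.map f w) := rfl

theorem pullback_pullback_of_comp_eq {f : L →ₗ[R] M} {k : M →ₗ[R] N} {l : L →ₗ[R] N}
    (h : ∀ x, k (f x) = l x) (α : Module.Dual R (ExteriorAlgebra R N)) :
    pullback R f (pullback R k α) = pullback R l α := by
  obtain rfl : k ∘ₗ f = l := LinearMap.ext h
  refine LinearMap.ext fun w => ?_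
  simp [← ExteriorAlgebra.map_comp_map]

theorem pullback_id (α : Module.Dual R (ExteriorAlgebra R L)) :
    pullback R (LinearMap.id : L →ₗ[R] L) α = α := by
  refine LinearMap.ext fun w => ?_
  simp [ExteriorAlgebra.map_id]

theorem mem_antiPrimitives_iff {f : L →ₗ[R] L} {α : Module.Dual R (ExteriorAlgebra R L)} :
    α ∈ antiPrimitives R f ↔ α ∈ primitives R L ∧ pullback R f α = -α := by
  rw [antiPrimitives, Submodule.mem_inf, Module.End.mem_eigenspace_iff, neg_one_smul]

end Pullback

section LieModule

variable {R : Type*} [CommRing R] {V B : Type*} [AddCommGroup V] [Module R V] [Ring B]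
  [Algebra R B]

theorem linearMap_ext_of_leibniz (f : ExteriorAlgebra R V →ₐ[R] B)
    {D D' : ExteriorAlgebra R V →ₗ[R] B} (hD : ∀ v w, D (v * w) = D v * f w + f v * D w)
    (hD' : ∀ v w, D' (v * w) = D' v * f w + f v * D' w) (h : ∀ m, D (ι R m) = D' (ι R m)) :
    D = D' := by
  have map_one_eq_zero {E : ExteriorAlgebra R V →ₗ[R] B}
      (hE : ∀ v w, E (v * w) = E v * f w + f v * E w) : E 1 = 0 := by
    simpa using hE 1 1
  refine LinearMap.ext fun w => ?_
  induction w using ExteriorAlgebra.induction with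
  | algebraMap r => simp [Algebra.algebraMap_eq_smul_one, map_one_eq_zero hD, map_one_eq_zero hD']
  | ι m => exact h m
  | mul v w hv hw => rw [hD, hD', hv, hw]
  | add v w hv hw => rw [map_add, map_add, hv, hw]

variable {L : Type*} [LieRing L] [LieAlgebra R L]

theorem adExt_eq_of_ι {X : L} {D : Module.End R (ExteriorAlgebra R L)}
    (hD : ∀ v w, D (v * w) = D v * w + v * D w) (h : ∀ m, D (ι R m) = ι R ⁅X, m⁆) :
    adExt R X = D :=
  linearMap_ext_of_leibniz (AlgHom.id R _) (adExt_mul R X) hD fun m => by rw [adExt_ι, h]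

theorem adExt_add (X Y : L) : adExt R (X + Y) = adExt R X + adExt R Y :=
  adExt_eq_of_ι (fun v w => by simp only [LinearMap.add_apply, adExt_mul]; noncomm_ring)
    fun m => by simp [adExt_ι]

theorem adExt_smul (r : R) (X : L) : adExt R (r • X) = r • adExt R X :=
  adExt_eq_of_ι (fun v w => by simp [adExt_mul]) fun m => by simp [adExt_ι]

theorem adExt_lie (X Y : L) : adExt R ⁅X, Y⁆ = ⁅adExt R X, adExt R Y⁆ :=
  adExt_eq_of_ι
    (fun v w => by
      simp only [Ring.lie_def, LinearMap.sub_apply, Module.End.mul_apply, adExt_mul, map_add]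
      noncomm_ring)
    fun m => by simp [Ring.lie_def, adExt_ι]

/-- The action of `L` on `Λ L` by `adExt`. As an instance it makes `A ⊗ L` act on `A ⊗ Λ L`. -/
instance : LieRingModule L (ExteriorAlgebra R L) where
  bracket X w := adExt R X w
  add_lie X Y w := by rw [adExt_add, LinearMap.add_apply]
  lie_add X v w := map_add _ v w
  leibniz_lie X Y w := by simp [adExt_lie, Ring.lie_def]

instance : LieModule R L (ExteriorAlgebra R L) where
  smul_lie r X w := by
    change adExt R (r • X) w = r • adExt R X w
    rw [adExt_smul, LinearMap.smul_apply]
  lie_smul r X w := map_smul (adExt R X) r w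

theorem lie_eq_adExt (X : L) (w : ExteriorAlgebra R L) : ⁅X, w⁆ = adExt R X w := rfl

variable {A : Type*} [CommRing A] [Algebra R A]

theorem lie_baseChange_ι (s t : A ⊗[R] L) :
    ⁅s, (ι R).baseChange A t⁆ = (ι R).baseChange A ⁅s, t⁆ := by
  induction s with
  | zero => simp
  | add s s' hs hs' => simp only [add_lie, hs, hs', map_add]
  | tmul a X =>
    induction t with
    | zero => simp
    | add t t' ht ht' => simp only [lie_add, ht, ht', map_add]
    | tmul b Y => simp [lie_eq_adExt, adExt_ι]

theorem lie_mul_baseChange (s : A ⊗[R] L) (v w : A ⊗[R] ExteriorAlgebra R L) :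
    ⁅s, v * w⁆ = ⁅s, v⁆ * w + v * ⁅s, w⁆ := by
  induction s with
  | zero => simp
  | add s s' hs hs' => simp only [add_lie, hs, hs', add_mul, mul_add]; abel
  | tmul a X =>
    induction v with
    | zero => simp
    | add v v' hv hv' => simp only [add_mul, lie_add, hv, hv']; abel
    | tmul b v =>
      induction w with
      | zero => simp
      | add w w' hw hw' => simp only [mul_add, lie_add, hw, hw']; abel
      | tmul c w => simp [lie_eq_adExt, adExt_mul, tmul_add, mul_assoc, mul_left_comm]

end LieModule

section Slice

variable {R A M N : Type*} [CommSemiring R] [CommSemiring A] [Algebra R A] [AddCommMonoid M]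
  [Module R M] [AddCommMonoid N] [Module R N]

/-- The slice map `A ⊗ M → M`, `a ⊗ m ↦ ρ(a) m`, of a linear form `ρ` on `A`. -/
def slice (ρ : Module.Dual R A) : A ⊗[R] M →ₗ[R] M :=
  TensorProduct.lid R M ∘ₗ ρ.rTensor M

@[simp]
theorem slice_tmul (ρ : Module.Dual R A) (a : A) (m : M) : slice ρ (a ⊗ₜ[R] m) = ρ a • m := by
  simp [slice]

theorem slice_baseChange (ρ : Module.Dual R A) (f : M →ₗ[R] N) (t : A ⊗[R] M) :
    slice ρ (f.baseChange A t) = f (slice ρ t) := by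
  induction t with
  | zero => simp
  | add s t hs ht => simp only [map_add, hs, ht]
  | tmul a m => simp

variable {p : Submodule R M}

theorem slice_mem_of_mem_baseChange (ρ : Module.Dual R A) {t : A ⊗[R] M}
    (ht : t ∈ p.baseChange A) : slice ρ t ∈ p := by
  obtain ⟨s, rfl⟩ := ht
  rw [slice_baseChange]
  exact (slice ρ s).2

theorem mem_baseChange_of_slice_mem [Module.Free R A] {t : A ⊗[R] M}
    (ht : ∀ ρ : Module.Dual R A, slice ρ t ∈ p) : t ∈ p.baseChange A := by
  let b := Module.Free.chooseBasis R A
  have slice_coord (i) : equivFinsuppOfBasisLeft b t i = slice (b.coord i) t :=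
    equivFinsuppOfBasisLeft_apply b t i
  rw [← (equivFinsuppOfBasisLeft b).symm_apply_apply t, equivFinsuppOfBasisLeft_symm_apply]
  refine Submodule.sum_mem _ fun i _ => ?_
  exact Submodule.tmul_mem_baseChange_of_mem _ (slice_coord i ▸ ht _)

theorem mul_mem_baseChange_mul {B : Type*} [Semiring B] [Algebra R B] {p q : Submodule R B}
    {s t : A ⊗[R] B} (hs : s ∈ p.baseChange A) (ht : t ∈ q.baseChange A) :
    s * t ∈ (p * q).baseChange A := by
  rw [Submodule.baseChange_eq_span] at hs ht
  induction hs, ht using Submodule.span_induction₂ with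
  | mem_mem x y hx hy =>
    obtain ⟨x, hx, rfl⟩ := hx
    obtain ⟨y, hy, rfl⟩ := hy
    simpa using Submodule.tmul_mem_baseChange_of_mem (1 : A) (Submodule.mul_mem_mul hx hy)
  | zero_left | zero_right => simp
  | add_left x y z _ _ _ h h' => rw [add_mul]; exact add_mem h h'
  | add_right x y z _ _ _ h h' => rw [mul_add]; exact add_mem h h'
  | smul_left a x y _ _ h => rw [smul_mul_assoc]; exact Submodule.smul_mem _ a h
  | smul_right a x y _ _ h => rw [mul_smul_comm]; exact Submodule.smul_mem _ a h

end Slice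

section ExteriorMap

variable {R A V W : Type*} [CommRing R] [CommRing A] [Algebra R A] [AddCommGroup V] [Module R V]
  [AddCommGroup W] [Module R W]

theorem baseChange_ι_mul_swap (s t : A ⊗[R] V) :
    (ι R).baseChange A s * (ι R).baseChange A t + (ι R).baseChange A t * (ι R).baseChange A s
      = 0 := by
  induction s with
  | zero => simp
  | add s s' hs hs' =>
    rw [map_add, add_mul, mul_add, add_add_add_comm, hs, hs', add_zero]
  | tmul a v =>
    induction t with
    | zero => simp
    | add t t' ht ht' => rw [map_add, add_mul, mul_add, add_add_add_comm, ht, ht', add_zero]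
    | tmul b w => simp [mul_comm b a, ← tmul_add, ι_add_mul_swap]

theorem baseChange_ι_sq (t : A ⊗[R] V) :
    (ι R).baseChange A t * (ι R).baseChange A t = 0 := by
  induction t with
  | zero => simp
  | add s t hs ht =>
    rw [map_add, add_mul, mul_add, mul_add, hs, ht, zero_add, add_zero, baseChange_ι_mul_swap]
  | tmul a v => simp

/-- The algebra homomorphism `Λ V → A ⊗ Λ W` induced by an `A`-linear map
`Φ : A ⊗ V → A ⊗ W`. Its target stands for the exterior algebra of the `A`-module `A ⊗ W`. -/
def exteriorMap (Φ : A ⊗[R] V →ₗ[A] A ⊗[R] W) :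
    ExteriorAlgebra R V →ₐ[R] A ⊗[R] ExteriorAlgebra R W :=
  ExteriorAlgebra.lift R
    ⟨((ι R).baseChange A ∘ₗ Φ).restrictScalars R ∘ₗ TensorProduct.mk R A V 1,
      fun v => baseChange_ι_sq (Φ (1 ⊗ₜ v))⟩

@[simp]
theorem exteriorMap_ι (Φ : A ⊗[R] V →ₗ[A] A ⊗[R] W) (v : V) :
    exteriorMap Φ (ι R v) = (ι R).baseChange A (Φ (1 ⊗ₜ v)) := by
  simp [exteriorMap]

theorem exteriorMap_baseChange (f : V →ₗ[R] W) (w : ExteriorAlgebra R V) :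
    exteriorMap (f.baseChange A) w = 1 ⊗ₜ ExteriorAlgebra.map f w := by
  have h : exteriorMap (f.baseChange A) =
      Algebra.TensorProduct.includeRight.comp (ExteriorAlgebra.map f) := by
    ext v
    simp
  exact DFunLike.congr_fun h w

theorem exteriorMap_map {V' W' : Type*} [AddCommGroup V'] [Module R V'] [AddCommGroup W']
    [Module R W'] {Φ : A ⊗[R] V →ₗ[A] A ⊗[R] W} {Φ' : A ⊗[R] V' →ₗ[A] A ⊗[R] W'}
    {f : V →ₗ[R] V'} {k : W →ₗ[R] W'} (h : ∀ v, Φ' (1 ⊗ₜ f v) = k.baseChange A (Φ (1 ⊗ₜ v)))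
    (w : ExteriorAlgebra R V) :
    exteriorMap Φ' (ExteriorAlgebra.map f w) =
      (ExteriorAlgebra.map k).toLinearMap.baseChange A (exteriorMap Φ w) := by
  have map_comp_ι : (ExteriorAlgebra.map k).toLinearMap ∘ₗ ι R = ι R ∘ₗ k := by
    ext v
    simp
  have baseChange_ι (t : A ⊗[R] W) : (ι R).baseChange A (k.baseChange A t) =
      (ExteriorAlgebra.map k).toLinearMap.baseChange A ((ι R).baseChange A t) := by
    simpa only [LinearMap.baseChange_comp, LinearMap.comp_apply] using
      (DFunLike.congr_fun (congrArg (LinearMap.baseChange A) map_comp_ι) t).symm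
  have key : (exteriorMap Φ').comp (ExteriorAlgebra.map f) =
      (Algebra.TensorProduct.map (AlgHom.id R A) (ExteriorAlgebra.map k)).comp
        (exteriorMap Φ) := by
    ext v
    simp only [AlgHom.comp_toLinearMap, LinearMap.comp_apply, AlgHom.toLinearMap_apply,
      map_apply_ι, exteriorMap_ι, h, baseChange_ι]
    rfl
  exact DFunLike.congr_fun key w

theorem baseChange_algebraMapInv_exteriorMap (Φ : A ⊗[R] V →ₗ[A] A ⊗[R] W)
    (w : ExteriorAlgebra R V) :
    (algebraMapInv (R := R) (M := W)).toLinearMap.baseChange A (exteriorMap Φ w) =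
      1 ⊗ₜ algebraMapInv w := by
  have algebraMapInv_comp_ι : (algebraMapInv (R := R) (M := W)).toLinearMap ∘ₗ ι R = 0 := by
    ext v
    simp [algebraMapInv]
  have baseChange_ι (t : A ⊗[R] W) :
      (algebraMapInv (R := R) (M := W)).toLinearMap.baseChange A ((ι R).baseChange A t) = 0 := by
    simpa [LinearMap.baseChange_comp] using
      DFunLike.congr_fun (congrArg (LinearMap.baseChange A) algebraMapInv_comp_ι) t
  have key : (Algebra.TensorProduct.map (AlgHom.id R A) algebraMapInv).comp (exteriorMap Φ) =
      Algebra.TensorProduct.includeRight.comp (algebraMapInv (R := R) (M := V)) := by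
    ext v
    simp only [AlgHom.comp_toLinearMap, LinearMap.comp_apply, AlgHom.toLinearMap_apply,
      exteriorMap_ι]
    exact (baseChange_ι _).trans (by simp [algebraMapInv])
  exact DFunLike.congr_fun key w

end ExteriorMap

section FormPullback

variable {R A V W : Type*} [CommRing R] [CommRing A] [Algebra R A] [AddCommGroup V] [Module R V]
  [AddCommGroup W] [Module R W]

/-- The map `Λ W* → Λ V*` that pulls forms back along an `A`-linear map `Φ : A ⊗ V → A ⊗ W` and
then applies the linear form `ρ` to their `A`-valued coefficients. -/
def formPullback (ρ : Module.Dual R A) (Φ : A ⊗[R] V →ₗ[A] A ⊗[R] W) :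
    Module.Dual R (ExteriorAlgebra R W) →ₗ[R] Module.Dual R (ExteriorAlgebra R V) :=
  (slice ρ ∘ₗ (exteriorMap Φ).toLinearMap).dualMap

@[simp]
theorem formPullback_apply (ρ : Module.Dual R A) (Φ : A ⊗[R] V →ₗ[A] A ⊗[R] W)
    (α : Module.Dual R (ExteriorAlgebra R W)) (w : ExteriorAlgebra R V) :
    formPullback ρ Φ α w = α (slice ρ (exteriorMap Φ w)) := rfl

end FormPullback

section Primitives

variable {R A : Type*} [CommRing R] [CommRing A] [Algebra R A] {L M : Type*} [LieRing L]
  [LieAlgebra R L] [LieRing M] [LieAlgebra R M]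

theorem formPullback_baseChange (ρ : Module.Dual R A) (f : L →ₗ[R] M)
    (α : Module.Dual R (ExteriorAlgebra R M)) :
    formPullback ρ (f.baseChange A) α = ρ 1 • pullback R f α := by
  refine LinearMap.ext fun w => ?_
  simp [exteriorMap_baseChange]

theorem pullback_formPullback {L' M' : Type*} [LieRing L'] [LieAlgebra R L'] [LieRing M']
    [LieAlgebra R M'] (ρ : Module.Dual R A) {Φ : A ⊗[R] L →ₗ[A] A ⊗[R] M}
    {Φ' : A ⊗[R] L' →ₗ[A] A ⊗[R] M'} {f : L →ₗ[R] L'} {k : M →ₗ[R] M'}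
    (h : ∀ v, Φ' (1 ⊗ₜ f v) = k.baseChange A (Φ (1 ⊗ₜ v)))
    (α : Module.Dual R (ExteriorAlgebra R M')) :
    pullback R f (formPullback ρ Φ' α) = formPullback ρ Φ (pullback R k α) := by
  refine LinearMap.ext fun w => ?_
  simp [exteriorMap_map h, slice_baseChange]

theorem exteriorMap_lie (Φ : A ⊗[R] L →ₗ⁅A⁆ A ⊗[R] M) (X : L) (w : ExteriorAlgebra R L) :
    exteriorMap (Φ : A ⊗[R] L →ₗ[A] A ⊗[R] M) ⁅X, w⁆ =
      ⁅Φ (1 ⊗ₜ X), exteriorMap (Φ : A ⊗[R] L →ₗ[A] A ⊗[R] M) w⁆ := by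
  let Ψ := exteriorMap (Φ : A ⊗[R] L →ₗ[A] A ⊗[R] M)
  have h : Ψ.toLinearMap ∘ₗ adExt R X =
      (LieModule.toEnd A (A ⊗[R] M) (A ⊗[R] ExteriorAlgebra R M)
        (Φ (1 ⊗ₜ X))).restrictScalars R ∘ₗ Ψ.toLinearMap := by
    refine linearMap_ext_of_leibniz Ψ (fun v w => ?_) (fun v w => ?_) fun m => ?_
    · simp [adExt_mul]
    · simp [lie_mul_baseChange]
    · simp [Ψ, adExt_ι, lie_baseChange_ι, ← LieHom.map_lie]
  exact DFunLike.congr_fun h w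

theorem apply_slice_lie_eq_zero (ρ : Module.Dual R A) {α : Module.Dual R (ExteriorAlgebra R M)}
    (hα : ∀ (X : M) (w : ExteriorAlgebra R M), α ⁅X, w⁆ = 0) (s : A ⊗[R] M)
    (t : A ⊗[R] ExteriorAlgebra R M) : α (slice ρ ⁅s, t⁆) = 0 := by
  induction s with
  | zero => simp
  | add s s' hs hs' => simp only [add_lie, map_add, hs, hs', add_zero]
  | tmul a X =>
    induction t with
    | zero => simp
    | add t t' ht ht' => simp only [lie_add, map_add, ht, ht', add_zero]
    | tmul b w => simp [hα]

variable {Φ : A ⊗[R] L →ₗ⁅A⁆ A ⊗[R] M}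

theorem lie_exteriorMap_eq_zero (hΦ : Function.Surjective Φ) {w : ExteriorAlgebra R L}
    (hw : ∀ X : L, ⁅X, w⁆ = 0) (t : A ⊗[R] M) :
    ⁅t, exteriorMap (Φ : A ⊗[R] L →ₗ[A] A ⊗[R] M) w⁆ = 0 := by
  obtain ⟨s, rfl⟩ := hΦ t
  induction s with
  | zero => simp
  | add s s' hs hs' => rw [map_add, add_lie, hs, hs', add_zero]
  | tmul a X =>
    rw [← mul_one a, ← smul_eq_mul, ← smul_tmul', map_smul, smul_lie, ← exteriorMap_lie, hw,
      map_zero, smul_zero]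

theorem slice_exteriorMap_mem_posInvariants (ρ : Module.Dual R A) (hΦ : Function.Surjective Φ)
    {w : ExteriorAlgebra R L} (hw : w ∈ posInvariants R L) :
    slice ρ (exteriorMap (Φ : A ⊗[R] L →ₗ[A] A ⊗[R] M) w) ∈ posInvariants R M := by
  constructor
  · rw [← AlgHom.toLinearMap_apply, ← slice_baseChange, baseChange_algebraMapInv_exteriorMap, hw.1,
      tmul_zero, map_zero]
  · intro Y
    have lie_eq_baseChange (t : A ⊗[R] ExteriorAlgebra R M) :
        ⁅(1 : A) ⊗ₜ[R] Y, t⁆ = (adExt R Y).baseChange A t :=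
      DFunLike.congr_fun (LieModule.toEnd_baseChange R A M (ExteriorAlgebra R M) Y) t
    rw [← slice_baseChange, ← lie_eq_baseChange, lie_exteriorMap_eq_zero hΦ hw.2, map_zero]

theorem formPullback_mem_primitives [Module.Free R A] (ρ : Module.Dual R A)
    (hΦ : Function.Surjective Φ) {α : Module.Dual R (ExteriorAlgebra R M)}
    (hα : α ∈ primitives R M) :
    formPullback ρ (Φ : A ⊗[R] L →ₗ[A] A ⊗[R] M) α ∈ primitives R L := by
  obtain ⟨apply_one, apply_lie, apply_mul⟩ := hα
  refine ⟨?_, fun X w => ?_, fun x hx y hy => ?_⟩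
  · simp [Algebra.TensorProduct.one_def, apply_one]
  · rw [formPullback_apply, ← lie_eq_adExt, exteriorMap_lie]
    exact apply_slice_lie_eq_zero ρ apply_lie _ _
  · have mem_baseChange {w} (hw : w ∈ posInvariants R L) :
        exteriorMap (Φ : A ⊗[R] L →ₗ[A] A ⊗[R] M) w ∈ (posInvariants R M).baseChange A :=
      mem_baseChange_of_slice_mem fun ρ => slice_exteriorMap_mem_posInvariants ρ hΦ hw
    have products_le_ker : posInvariants R M * posInvariants R M ≤ LinearMap.ker α :=
      Submodule.mul_le.2 apply_mul
    rw [formPullback_apply, map_mul]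
    exact products_le_ker <| slice_mem_of_mem_baseChange ρ <|
      mul_mem_baseChange_mul (mem_baseChange hx) (mem_baseChange hy)

theorem pullback_mem_primitives {f : L →ₗ⁅R⁆ M} (hf : Function.Surjective f)
    {α : Module.Dual R (ExteriorAlgebra R M)} (hα : α ∈ primitives R M) :
    pullback R (f : L →ₗ[R] M) α ∈ primitives R L := by
  have key := formPullback_mem_primitives (A := R) (LinearMap.id : R →ₗ[R] R)
    (Φ := LieAlgebra.ExtendScalars.map (AlgHom.id R R) f) (LinearMap.lTensor_surjective R hf) hα
  have h : ((LieAlgebra.ExtendScalars.map (AlgHom.id R R) f : R ⊗[R] L →ₗ⁅R⁆ R ⊗[R] M) :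
      R ⊗[R] L →ₗ[R] R ⊗[R] M) = (f : L →ₗ[R] M).baseChange R := by
    ext
    simp
  rwa [h, formPullback_baseChange, LinearMap.id_apply, one_smul] at key

theorem formPullback_mem_antiPrimitives [Module.Free R A] (ρ : Module.Dual R A)
    (hΦ : Function.Surjective Φ) {k : L →ₗ[R] L} {l : M →ₗ[R] M}
    (h : ∀ X, Φ (1 ⊗ₜ k X) = l.baseChange A (Φ (1 ⊗ₜ X)))
    {α : Module.Dual R (ExteriorAlgebra R M)} (hα : α ∈ antiPrimitives R l) :
    formPullback ρ (Φ : A ⊗[R] L →ₗ[A] A ⊗[R] M) α ∈ antiPrimitives R k := by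
  obtain ⟨hαP, hαl⟩ := mem_antiPrimitives_iff.1 hα
  refine mem_antiPrimitives_iff.2 ⟨formPullback_mem_primitives ρ hΦ hαP, ?_⟩
  rw [pullback_formPullback ρ h, hαl, map_neg]

theorem pullback_mem_antiPrimitives {f : L →ₗ⁅R⁆ M} (hf : Function.Surjective f) {k : L →ₗ[R] L}
    {l : M →ₗ[R] M} (h : ∀ X, f (k X) = l (f X)) {α : Module.Dual R (ExteriorAlgebra R M)}
    (hα : α ∈ antiPrimitives R l) : pullback R (f : L →ₗ[R] M) α ∈ antiPrimitives R k := by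
  obtain ⟨hαP, hαl⟩ := mem_antiPrimitives_iff.1 hα
  refine mem_antiPrimitives_iff.2 ⟨pullback_mem_primitives hf hαP, ?_⟩
  rw [← map_neg, ← hαl]
  exact (pullback_pullback_of_comp_eq (l := l ∘ₗ (f : L →ₗ[R] M)) h α).trans
    (pullback_pullback_of_comp_eq (fun _ => rfl) α).symm

end Primitives

section RestrictionSurjective

variable {R : Type*} [CommRing R] {L L' : Type*} [LieRing L] [LieAlgebra R L] [LieRing L']
  [LieAlgebra R L'] {h : LieSubalgebra R L} {h' : LieSubalgebra R L'}

-- Averaging over `σ` turns a `(-1)`-eigenvector of `θ` into one of `θ ∘ σ`.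
theorem RestrictionSurjective.comp_of_fixes [Invertible (2 : R)] {θ σ : L →ₗ⁅R⁆ L}
    {hθ : ∀ X ∈ h, θ X ∈ h} {hτ : ∀ X ∈ h, θ.comp σ X ∈ h} (hσ : Function.Involutive σ)
    (hc : ∀ X, θ (σ X) = σ (θ X)) (hσh : ∀ X ∈ h, σ X = X) (H : RestrictionSurjective h θ hθ) :
    RestrictionSurjective h (θ.comp σ) hτ := by
  intro β hβ
  have restrict_eq : ((θ.comp σ : L →ₗ⁅R⁆ L) : L →ₗ[R] L).restrict (p := h.toSubmodule) hτ =
      (θ : L →ₗ[R] L).restrict (p := h.toSubmodule) hθ := by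
    ext X
    simp [hσh X X.2]
  rw [restrict_eq] at hβ
  obtain ⟨α, hα, rfl⟩ := H hβ
  obtain ⟨hαP, hαθ⟩ := mem_antiPrimitives_iff.1 hα
  have pullback_comp : pullback R (θ.comp σ : L →ₗ[R] L) α = -pullback R (σ : L →ₗ[R] L) α := by
    rw [← map_neg, ← hαθ]
    exact (pullback_pullback_of_comp_eq (fun _ => rfl) α).symm
  have pullback_comp_pullback :
      pullback R (θ.comp σ : L →ₗ[R] L) (pullback R (σ : L →ₗ[R] L) α) = -α := by
    rw [← hαθ]
    exact pullback_pullback_of_comp_eq (fun X => by simp [← hc, hσ X]) α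
  have pullback_incl : pullback R (h.incl : h →ₗ[R] L) (pullback R (σ : L →ₗ[R] L) α) =
      pullback R (h.incl : h →ₗ[R] L) α :=
    pullback_pullback_of_comp_eq (fun X => hσh _ X.2) α
  refine ⟨⅟(2 : R) • (α + pullback R (σ : L →ₗ[R] L) α), mem_antiPrimitives_iff.2 ⟨?_, ?_⟩, ?_⟩
  · exact Submodule.smul_mem _ _ (add_mem hαP (pullback_mem_primitives hσ.surjective hαP))
  · rw [map_smul, map_add, pullback_comp, pullback_comp_pullback, ← neg_add_rev, smul_neg]
  · rw [map_smul, map_add, pullback_incl, ← two_smul R, invOf_smul_smul]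

theorem restrictionSurjective_comp_iff [Invertible (2 : R)] {θ σ : L →ₗ⁅R⁆ L}
    {hθ : ∀ X ∈ h, θ X ∈ h} {hτ : ∀ X ∈ h, θ.comp σ X ∈ h} (hσ : Function.Involutive σ)
    (hc : ∀ X, θ (σ X) = σ (θ X)) (hσh : ∀ X ∈ h, σ X = X) :
    RestrictionSurjective h (θ.comp σ) hτ ↔ RestrictionSurjective h θ hθ := by
  refine ⟨fun H => ?_, .comp_of_fixes hσ hc hσh⟩
  have comp_comp : (θ.comp σ).comp σ = θ := LieHom.ext fun X => congrArg θ (hσ X)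
  have key := H.comp_of_fixes (hτ := by rwa [comp_comp]) hσ (fun X => hc (σ X)) hσh
  simpa only [comp_comp] using key

variable {A : Type*} [CommRing A] [Algebra R A] [Module.Free R A] {ρ : Module.Dual R A}
  {τ : L →ₗ⁅R⁆ L} {hτ : ∀ X ∈ h, τ X ∈ h} {τ' : L' →ₗ⁅R⁆ L'} {hτ' : ∀ X ∈ h', τ' X ∈ h'}

theorem RestrictionSurjective.of_baseChange_equiv (hρ : ρ 1 = 1)
    (Φ : (A ⊗[R] L') ≃ₗ⁅A⁆ (A ⊗[R] L))
    (hΦ : ∀ t, Φ ((τ' : L' →ₗ[R] L').baseChange A t) = (τ : L →ₗ[R] L).baseChange A (Φ t))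
    (e : h' ≃ₗ⁅R⁆ h) (he : ∀ X : h', Φ (1 ⊗ₜ (X : L')) = 1 ⊗ₜ (e X : L))
    (H : RestrictionSurjective h τ hτ) : RestrictionSurjective h' τ' hτ' := by
  intro β hβ
  have map_e (X : h') : e ⟨τ' X, hτ' X X.2⟩ = ⟨τ (e X), hτ _ (e X).2⟩ := by
    have one_tmul_map_e : (1 : A) ⊗ₜ[R] (e ⟨τ' X, hτ' X X.2⟩ : L) = 1 ⊗ₜ τ (e X) := by
      simpa [he] using (he ⟨τ' X, hτ' X X.2⟩).symm.trans (hΦ (1 ⊗ₜ X))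
    exact Subtype.ext (by simpa [hρ] using congrArg (slice ρ) one_tmul_map_e)
  have map_e_symm (Y : h) : e.symm ⟨τ Y, hτ Y Y.2⟩ = ⟨τ' (e.symm Y), hτ' _ (e.symm Y).2⟩ := by
    rw [← e.symm_apply_apply ⟨τ' (e.symm Y), _⟩, map_e]
    simp only [e.apply_symm_apply]
  obtain ⟨α, hα, hαβ⟩ := H (pullback_mem_antiPrimitives (f := e.symm.toLieHom)
    (k := (τ : L →ₗ[R] L).restrict (p := h.toSubmodule) hτ)
    (l := (τ' : L' →ₗ[R] L').restrict (p := h'.toSubmodule) hτ') e.symm.surjective map_e_symm hβ)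
  refine ⟨formPullback ρ (Φ.toLieHom : A ⊗[R] L' →ₗ[A] A ⊗[R] L) α,
    formPullback_mem_antiPrimitives ρ Φ.surjective (fun X => ?_) hα, ?_⟩
  · simpa using hΦ (1 ⊗ₜ X)
  · rw [pullback_formPullback ρ (Φ := (e.toLieHom : h' →ₗ[R] h).baseChange A)
      (k := (h.incl : h →ₗ[R] L)) fun X => by simpa using he X, hαβ, formPullback_baseChange,
      hρ, one_smul, pullback_pullback_of_comp_eq (l := LinearMap.id) e.symm_apply_apply,
      pullback_id]

theorem restrictionSurjective_iff_of_baseChange_equiv (hρ : ρ 1 = 1)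
    (Φ : (A ⊗[R] L') ≃ₗ⁅A⁆ (A ⊗[R] L))
    (hΦ : ∀ t, Φ ((τ' : L' →ₗ[R] L').baseChange A t) = (τ : L →ₗ[R] L).baseChange A (Φ t))
    (e : h' ≃ₗ⁅R⁆ h) (he : ∀ X : h', Φ (1 ⊗ₜ (X : L')) = 1 ⊗ₜ (e X : L)) :
    RestrictionSurjective h τ hτ ↔ RestrictionSurjective h' τ' hτ' := by
  refine ⟨.of_baseChange_equiv hρ Φ hΦ e he,
    .of_baseChange_equiv hρ Φ.symm (fun t => ?_) e.symm fun Y => ?_⟩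
  · rw [← Φ.symm_apply_apply ((τ' : L' →ₗ[R] L').baseChange A _), hΦ, Φ.apply_symm_apply]
  · rw [← Φ.symm_apply_apply (1 ⊗ₜ (e.symm Y : L')), he, e.apply_symm_apply]

end RestrictionSurjective

section Form

variable {R A L N : Type*} [CommRing R] [CommRing A] [Algebra R A] [LieRing L] [LieAlgebra R L]
  [LieRing N] [LieAlgebra R N] [LieAlgebra A N] [IsScalarTower R A N]

/-- The homomorphism `A ⊗ L → N` of Lie algebras over `A` that extends a homomorphism `L → N` of
Lie algebras over `R`. -/
def extendScalarsLift (f : L →ₗ⁅R⁆ N) : A ⊗[R] L →ₗ⁅A⁆ N where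
  __ := LinearMap.liftBaseChange A (f : L →ₗ[R] N)
  map_lie' {s t} := by
    change LinearMap.liftBaseChange A (f : L →ₗ[R] N) ⁅s, t⁆ =
      ⁅LinearMap.liftBaseChange A (f : L →ₗ[R] N) s, LinearMap.liftBaseChange A (f : L →ₗ[R] N) t⁆
    induction s with
    | zero => simp
    | add s s' hs hs' => simp only [add_lie, map_add, hs, hs']
    | tmul a X =>
      induction t with
      | zero => simp
      | add t t' ht ht' => simp only [lie_add, map_add, ht, ht']
      | tmul b Y => simp [smul_smul, mul_comm]

@[simp]
theorem extendScalarsLift_tmul (f : L →ₗ⁅R⁆ N) (a : A) (X : L) :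
    extendScalarsLift f (a ⊗ₜ[R] X) = a • f X :=
  LinearMap.liftBaseChange_tmul ..

end Form

section CDualForm

variable {g : Type*} [LieRing g] [LieAlgebra ℝ g] {σ : g →ₗ⁅ℝ⁆ g}

/-- The `h`-component of an element of `g = h ⊕ q`, as an element of `g^c`. -/
def fixedPart (hσ : Function.Involutive σ) : g →ₗ[ℝ] cDual σ :=
  LinearMap.codRestrict (cDual σ).toSubmodule
    (TensorProduct.mk ℝ ℂ g 1 ∘ₗ ((2⁻¹ : ℝ) • (LinearMap.id + (σ : g →ₗ[ℝ] g))))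
    fun X => ⟨(2⁻¹ : ℝ) • (X + σ X), 0, by simp [hσ X, add_comm], by simp, by simp⟩

/-- The `q`-component of an element of `g = h ⊕ q`, multiplied by `√-1` to lie in `g^c`. -/
def antiFixedPart (hσ : Function.Involutive σ) : g →ₗ[ℝ] cDual σ :=
  LinearMap.codRestrict (cDual σ).toSubmodule
    (TensorProduct.mk ℝ ℂ g Complex.I ∘ₗ ((2⁻¹ : ℝ) • (LinearMap.id - (σ : g →ₗ[ℝ] g))))
    fun X => ⟨0, (2⁻¹ : ℝ) • (X - σ X), by simp, by simp [hσ X, ← smul_neg], by simp⟩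

@[simp]
theorem coe_fixedPart (hσ : Function.Involutive σ) (X : g) :
    (fixedPart hσ X : ℂ ⊗[ℝ] g) = 1 ⊗ₜ ((2⁻¹ : ℝ) • (X + σ X)) := rfl

@[simp]
theorem coe_antiFixedPart (hσ : Function.Involutive σ) (X : g) :
    (antiFixedPart hσ X : ℂ ⊗[ℝ] g) = Complex.I ⊗ₜ ((2⁻¹ : ℝ) • (X - σ X)) := rfl

/-- The embedding of `g = h ⊕ q` into `ℂ ⊗ g^c`, where `q = -√-1 (√-1 q)`. -/
def toComplexifiedCDual (hσ : Function.Involutive σ) : g →ₗ[ℝ] ℂ ⊗[ℝ] cDual σ :=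
  TensorProduct.mk ℝ ℂ (cDual σ) 1 ∘ₗ fixedPart hσ -
    TensorProduct.mk ℝ ℂ (cDual σ) Complex.I ∘ₗ antiFixedPart hσ

theorem extendScalarsLift_toComplexifiedCDual (hσ : Function.Involutive σ) (X : g) :
    extendScalarsLift (A := ℂ) (cDual σ).incl (toComplexifiedCDual hσ X) = 1 ⊗ₜ X := by
  simp only [toComplexifiedCDual, LinearMap.sub_apply, LinearMap.comp_apply, mk_apply, map_sub,
    extendScalarsLift_tmul, LieSubalgebra.coe_incl, coe_fixedPart, coe_antiFixedPart, smul_tmul',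
    smul_eq_mul, Complex.I_mul_I, neg_tmul, sub_neg_eq_add, one_smul, ← tmul_add]
  congr 1
  module

theorem liftBaseChange_toComplexifiedCDual (hσ : Function.Involutive σ) (z : cDual σ) :
    (toComplexifiedCDual hσ).liftBaseChange ℂ (z : ℂ ⊗[ℝ] g) = 1 ⊗ₜ z := by
  obtain ⟨_, X, Y, hX, hY, rfl⟩ := z
  have fixedPart_X : fixedPart hσ X = ⟨1 ⊗ₜ X, X, 0, hX, by simp, by simp⟩ := by
    ext
    simp [hX, ← two_smul ℝ X, smul_smul]
  have antiFixedPart_X : antiFixedPart hσ X = 0 := by ext; simp [hX]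
  have fixedPart_Y : fixedPart hσ Y = 0 := by ext; simp [hY]
  have antiFixedPart_Y :
      antiFixedPart hσ Y = ⟨Complex.I ⊗ₜ Y, 0, Y, by simp, hY, by simp⟩ := by
    ext
    simp [hY, ← two_smul ℝ Y, smul_smul]
  rw [map_add, LinearMap.liftBaseChange_tmul, LinearMap.liftBaseChange_tmul]
  simp only [toComplexifiedCDual, LinearMap.sub_apply, LinearMap.comp_apply, mk_apply, fixedPart_X,
    antiFixedPart_X, fixedPart_Y, antiFixedPart_Y, tmul_zero, sub_zero, zero_sub, smul_neg,
    smul_tmul', smul_eq_mul, one_mul, Complex.I_mul_I, neg_tmul, neg_neg, ← tmul_add]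
  rfl

/-- `ℂ ⊗ g^c` is isomorphic to `ℂ ⊗ g`: both `g` and `g^c` are real forms of it. -/
def cDualComplexification (hσ : Function.Involutive σ) : (ℂ ⊗[ℝ] cDual σ) ≃ₗ⁅ℂ⁆ (ℂ ⊗[ℝ] g) where
  __ := extendScalarsLift (cDual σ).incl
  invFun := (toComplexifiedCDual hσ).liftBaseChange ℂ
  left_inv t := by
    change (toComplexifiedCDual hσ).liftBaseChange ℂ (extendScalarsLift (cDual σ).incl t) = t
    induction t with
    | zero => simp
    | add s t hs ht => rw [map_add, map_add, hs, ht]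
    | tmul a z => simp [liftBaseChange_toComplexifiedCDual, smul_tmul']
  right_inv t := by
    change extendScalarsLift (cDual σ).incl ((toComplexifiedCDual hσ).liftBaseChange ℂ t) = t
    induction t with
    | zero => simp
    | add s t hs ht => rw [map_add, map_add, hs, ht]
    | tmul a X => simp [extendScalarsLift_toComplexifiedCDual, smul_tmul']

@[simp]
theorem cDualComplexification_tmul (hσ : Function.Involutive σ) (a : ℂ) (z : cDual σ) :
    cDualComplexification hσ (a ⊗ₜ z) = a • (z : ℂ ⊗[ℝ] g) :=
  extendScalarsLift_tmul _ a z

theorem cDualComplexification_thetaC (hσ : Function.Involutive σ) {θ : g →ₗ⁅ℝ⁆ g}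
    (hc : ∀ X, θ (σ X) = σ (θ X)) (t : ℂ ⊗[ℝ] cDual σ) :
    cDualComplexification hσ ((thetaC hc : cDual σ →ₗ[ℝ] cDual σ).baseChange ℂ t) =
      (θ.comp σ : g →ₗ[ℝ] g).baseChange ℂ (cDualComplexification hσ t) := by
  induction t with
  | zero => simp
  | add s t hs ht => simp only [map_add, hs, ht]
  | tmul a z =>
    rw [LinearMap.baseChange_tmul, cDualComplexification_tmul, cDualComplexification_tmul, map_smul]
    rfl

/-- The identification of `h ⊂ g^c` with `h ⊂ g`. -/
def cDualFixedEquiv (σ : g →ₗ⁅ℝ⁆ g) : cDualFixed σ ≃ₗ⁅ℝ⁆ fixed σ where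
  toFun z := ⟨slice Complex.reLm (z : ℂ ⊗[ℝ] g), by
    obtain ⟨z, X, hX, hz⟩ := z
    have hX : X ∈ fixed σ := hX
    simpa [hz] using hX⟩
  map_add' z w := by ext; simp
  map_smul' c z := by ext; simp
  map_lie' {z w} := by
    obtain ⟨z, X, hX, hz⟩ := z
    obtain ⟨w, Y, hY, hw⟩ := w
    ext
    simp [hz, hw]
  invFun X := ⟨⟨1 ⊗ₜ X, X, 0, X.2, by simp, by simp⟩, X, X.2, rfl⟩
  left_inv z := by
    obtain ⟨z, X, hX, hz⟩ := z
    ext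
    simp [hz]
  right_inv X := by ext; simp

theorem one_tmul_cDualFixedEquiv (z : cDualFixed σ) :
    (1 : ℂ) ⊗ₜ[ℝ] (cDualFixedEquiv σ z : g) = ((z : cDual σ) : ℂ ⊗[ℝ] g) :=
  congrArg (fun w : cDualFixed σ => ((w : cDual σ) : ℂ ⊗[ℝ] g))
    ((cDualFixedEquiv σ).symm_apply_apply z)

end CDualForm

end CDual

end

theorem mainTheorem10_general (g : Type*) [LieRing g] [LieAlgebra ℝ g]
    (σ : g →ₗ⁅ℝ⁆ g) (hσ : Function.Involutive σ) (θ : g →ₗ⁅ℝ⁆ g)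
    (hc : ∀ X, θ (σ X) = σ (θ X)) :
    CDual.RestrictionSurjective (CDual.fixed σ) θ (CDual.map_mem_fixed hc) ↔
      CDual.RestrictionSurjective (CDual.cDualFixed σ) (CDual.thetaC hc)
        (CDual.thetaC_mem hc) := by
  have comp_mem_fixed : ∀ X ∈ CDual.fixed σ, θ.comp σ X ∈ CDual.fixed σ :=
    CDual.map_mem_fixed fun X => hc (σ X)
  calc
    CDual.RestrictionSurjective (CDual.fixed σ) θ (CDual.map_mem_fixed hc)
      ↔ CDual.RestrictionSurjective (CDual.fixed σ) (θ.comp σ) comp_mem_fixed :=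
        (CDual.restrictionSurjective_comp_iff hσ hc fun _ hX => hX).symm
    _ ↔ CDual.RestrictionSurjective (CDual.cDualFixed σ) (CDual.thetaC hc)
        (CDual.thetaC_mem hc) :=
        CDual.restrictionSurjective_iff_of_baseChange_equiv (ρ := Complex.reLm) Complex.one_re
          (CDual.cDualComplexification hσ) (CDual.cDualComplexification_thetaC hσ hc)
          (CDual.cDualFixedEquiv σ) fun z => by
            rw [CDual.cDualComplexification_tmul, one_smul, CDual.one_tmul_cDualFixedEquiv]

theorem mainTheorem10 (g : Type*) [LieRing g] [LieAlgebra ℝ g] [FiniteDimensional ℝ g]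
    [LieAlgebra.IsSemisimple ℝ g]
    (σ : g →ₗ⁅ℝ⁆ g) (hσ : Function.Involutive σ)
    (θ : g →ₗ⁅ℝ⁆ g) (hθ : CDual.IsCartanInvolution θ)
    (hc : ∀ X, θ (σ X) = σ (θ X)) :
    CDual.RestrictionSurjective (CDual.fixed σ) θ (CDual.map_mem_fixed hc) ↔
      CDual.RestrictionSurjective (CDual.cDualFixed σ) (CDual.thetaC hc)
        (CDual.thetaC_mem hc) :=
  mainTheorem10_general g σ hσ θ hc
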